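/- Let $P_N$ be the path graph with vertex set $\{0,1,\dots,N-1\}$, $N\ge 1$, in which $i$ and $i+1$ are adjacent, and let $L$ be its Laplacian matrix. Consider the noisy second-order consensus dynamics $$\dot x_1(t)=x_2(t),\qquad \dot x_2(t)=-L\,x_1(t)-L\,x_2(t)+w(t),\qquad t\ge 0,$$ where $w$ is an $N$-vector of uncorrelated unit-intensity Gaussian white noise processes; that is, almost surely, for all $t\ge 0$, $$x_1(t)=x_1(0)+\int_0^t x_2(s)\,ds,\qquad x_2(t)=x_2(0)-\int_0^t \bigl(Lx_1(s)+Lx_2(s)\bigr)\,ds+W(t),$$ where $W$ is a vector of $N$ independent standard Brownian motions, $x_1,x_2$ are $\mathbb R^N$-valued processes with continuous paths, and $x_1(0),x_2(0)$ are square integrable (for instance deterministic). Put $\bar x_1(t)=\frac1N\sum_{i=0}^{N-1}x_{1i}(t)$ and $$H_{SO}(j,k)=\lim_{t\to\infty}\mathbb E\bigl[(x_{1j}(t)-x_{1k}(t))^2\bigr],\qquad H_{SO}(j)=\lim_{t\to\infty}\mathbb E\bigl[(x_{1j}(t)-\bar x_1(t))^2\bigr],$$ $$H_{SO}(P_N)=\lim_{t\to\infty}\sum_{j=0}^{N-1}\mathbb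 E\bigl[(x_{1j}(t)-\bar x_1(t))^2\bigr].$$ Then these second moments are finite for every $t$, the limits exist, and the following hold. For all vertices $j,k$ with $k<j$, $$\begin{aligned}H_{SO}(j,k)=\frac12\Bigl(&\frac j6+\frac{j^2}2-\frac{j^2}{4N}+\frac{j^3}3-\frac{j^3}{2N}-\frac{j^4}{4N}-\frac k6-jk+\frac{jk}{2N}+\frac{j^2k}{2N}+\frac{k^2}2-\frac{k^2}{4N}\\&-jk^2+\frac{jk^2}{2N}+\frac{j^2k^2}{2N}+\frac{2k^3}3-\frac{k^3}{2N}-\frac{k^4}{4N}\Bigr).\end{aligned}$$ For every vertex $j$, $$H_{SO}(j)=\frac1{360N}\Bigl(4N^4-(60j^2+60j+5)N^2+60j(2j+1)(j+1)N-60j^2(j+1)^2+1\Bigr).$$ The total variance is $$H_{SO}(P_N)=\frac1{360}\bigl(2N^4+5N^2-7\bigr),$$ and consequently $H_{SO}(P_N)=\Theta(N^4)$ as $N\to\infty$. -/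

import Mathlib

open MeasureTheory ProbabilityTheory Filter Topology Asymptotics
open scoped NNReal

universe u

namespace NoisyConsensus

instance pathGraphDecidableRel (N : ℕ) : DecidableRel (SimpleGraph.pathGraph N).Adj :=
  fun _ _ => decidable_of_iff _ SimpleGraph.pathGraph_adj.symm

section

variable {Ω : Type*} [MeasurableSpace Ω] {V : Type*} [Fintype V]

/-- The integrated form of a vector of uncorrelated (unit intensity) Gaussian white noise
processes: a family of mutually independent standard Brownian motions, one for each index.
The independence is that of the whole trajectories. -/
structure IsIndepBrownianFamily (P : Measure Ω) (W : V → ℝ≥0 → Ω → ℝ) : Prop where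
  measurable : ∀ i t, Measurable (W i t)
  isBrownian : ∀ i, IsBrownianReal (W i) P
  indep : iIndepFun (fun i ω t => W i t ω) P

/-- The pair of processes `(x₁, x₂)` is a solution of the noisy second-order consensus dynamics
`ẋ₁ = x₂`, `ẋ₂ = -L x₁ - L x₂ + w` on the graph `G`, where `L` is the Laplacian matrix of `G`
and `w = dW/dt` is white noise. Since the noise is additive, the stochastic differential equation
is the pathwise integral equation below, valid for all times on almost every trajectory.
The initial state is any square integrable random vector, in particular any deterministic one. -/
structure IsSecondOrderConsensus [DecidableEq V] (G : SimpleGraph V) [DecidableRel G.Adj]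
    (P : Measure Ω) (W : V → ℝ≥0 → Ω → ℝ) (x₁ x₂ : ℝ≥0 → Ω → V → ℝ) : Prop where
  noise : IsIndepBrownianFamily P W
  measurable_fst : ∀ t, Measurable (x₁ t)
  measurable_snd : ∀ t, Measurable (x₂ t)
  initial_fst : MemLp (x₁ 0) 2 P
  initial_snd : MemLp (x₂ 0) 2 P
  continuous_fst : ∀ᵐ ω ∂P, Continuous (fun t => x₁ t ω)
  continuous_snd : ∀ᵐ ω ∂P, Continuous (fun t => x₂ t ω)
  equation_fst : ∀ᵐ ω ∂P, ∀ t : ℝ≥0,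
    x₁ t ω = x₁ 0 ω + ∫ s in (0 : ℝ)..t, x₂ s.toNNReal ω
  equation_snd : ∀ᵐ ω ∂P, ∀ t : ℝ≥0,
    x₂ t ω = x₂ 0 ω
      + (∫ s in (0 : ℝ)..t,
          (-(Matrix.mulVec (G.lapMatrix ℝ) (x₁ s.toNNReal ω))
            - Matrix.mulVec (G.lapMatrix ℝ) (x₂ s.toNNReal ω)))
      + fun i => W i t ω

/-- The average `(1 / N) ∑ i, x i` of a vector indexed by the `N` vertices. -/
noncomputable def average (x : V → ℝ) : ℝ := (∑ i, x i) / (Fintype.card V : ℝ)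

/-- `h` is the pairwise variance of `j` and `k`: the second moment of `x₁ⱼ(t) - x₁ₖ(t)` is finite
at all times, and it converges to `h` as `t → ∞`. -/
def IsPairwiseVariance (P : Measure Ω) (x₁ : ℝ≥0 → Ω → V → ℝ) (j k : V) (h : ℝ) : Prop :=
  (∀ t, Integrable (fun ω => (x₁ t ω j - x₁ t ω k) ^ 2) P) ∧
    Tendsto (fun t => ∫ ω, (x₁ t ω j - x₁ t ω k) ^ 2 ∂P) atTop (𝓝 h)

/-- `h` is the vertex variance of `j`: the second moment of the deviation of `x₁ⱼ(t)` from the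
current average is finite at all times, and it converges to `h` as `t → ∞`. -/
def IsVertexVariance (P : Measure Ω) (x₁ : ℝ≥0 → Ω → V → ℝ) (j : V) (h : ℝ) : Prop :=
  (∀ t, Integrable (fun ω => (x₁ t ω j - average (x₁ t ω)) ^ 2) P) ∧
    Tendsto (fun t => ∫ ω, (x₁ t ω j - average (x₁ t ω)) ^ 2 ∂P) atTop (𝓝 h)

/-- `h` is the total variance of the system: the second moments of the deviations from the current
average are finite at all times, and their sum over the vertices converges to `h` as `t → ∞`. -/
def IsTotalVariance (P : Measure Ω) (x₁ : ℝ≥0 → Ω → V → ℝ) (h : ℝ) : Prop :=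
  (∀ t j, Integrable (fun ω => (x₁ t ω j - average (x₁ t ω)) ^ 2) P) ∧
    Tendsto (fun t => ∑ j, ∫ ω, (x₁ t ω j - average (x₁ t ω)) ^ 2 ∂P) atTop (𝓝 h)

end

/-- Half of the explicit polynomial in `j`, `k` (with `k < j`) for a path with `N` vertices. -/
noncomputable def pathPairwise (N j k : ℝ) : ℝ :=
  (1 / 2) *
    (j / 6 + j ^ 2 / 2 - j ^ 2 / (4 * N) + j ^ 3 / 3 - j ^ 3 / (2 * N) - j ^ 4 / (4 * N)
      - k / 6 - j * k + j * k / (2 * N) + j ^ 2 * k / (2 * N) + k ^ 2 / 2 - k ^ 2 / (4 * N)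
      - j * k ^ 2 + j * k ^ 2 / (2 * N) + j ^ 2 * k ^ 2 / (2 * N) + 2 * k ^ 3 / 3
      - k ^ 3 / (2 * N) - k ^ 4 / (4 * N))

/-- The explicit expression for the vertex variance in a path with `N` vertices. -/
noncomputable def pathVertex (N j : ℝ) : ℝ :=
  1 / (360 * N) *
    (4 * N ^ 4 - (60 * j ^ 2 + 60 * j + 5) * N ^ 2 + 60 * j * (2 * j + 1) * (j + 1) * N
      - 60 * j ^ 2 * (j + 1) ^ 2 + 1)

/-- The explicit expression for the total variance in a path with `N` vertices. -/
noncomputable def pathTotal (N : ℝ) : ℝ :=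
  (2 * N ^ 4 + 5 * N ^ 2 - 7) / 360

end NoisyConsensus

/-! Along an eigenvector of `L` with eigenvalue `lam > 0`, the position is a damped oscillator `y''
+ lam y' + lam y` driven by a standard Brownian motion. If `g` is its impulse response, the initial
data are forgotten and the limiting variance is `∫₀^∞ g² = 1 / (2 lam²)`. Orthonormal eigenvectors
receive uncorrelated noise, so for `c = L u` with `u` orthogonal to `ker L` the variance of `c ⬝ᵥ
x₁(t)` tends to `∑ lam² (v ⬝ᵥ u)² / (2 lam²) = |u|² / 2`. The zero modes, which are not damped,
never enter, and no eigenvalue has to be known.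

For the path it remains to solve `L u = e_j - e_k` and `L u = e_j - 1/N`. Here `L` is a difference
of successive increments vanishing at both ends, so `u` is an explicit piecewise polynomial of
degree at most two. Its centred sum of squares gives the formulas; the total variance is the sum of
the vertex variances.

Stochastic integrals are avoided: integration by parts turns `∫ g(t - s) dW(s)` into the pathwise
integral `∫ k(t - s) W(s) ds` with `k = g'`. Its second moment follows from Fubini and the
covariance `min s r`. -/

namespace NoisyConsensus

/-! ### The damped oscillator: decay, energy of the impulse response, variation of constants. -/

/-- `(g, k)` is the impulse response of the damped oscillator `y'' + lam y' + lam y = 0`,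
together with its derivative. -/
structure IsImpulseResponse (lam : ℝ) (g k : ℝ → ℝ) : Prop where
  pos : 0 < lam
  hasDerivAt_fst : ∀ t, HasDerivAt g (k t) t
  hasDerivAt_snd : ∀ t, HasDerivAt k (-lam * g t - lam * k t) t
  fst_zero : g 0 = 0
  snd_zero : k 0 = 1

/-- The orbit of `(0, 1)` under the exponential of the companion operator works for every `lam`,
with no case distinction on the sign of `lam² - 4 lam`. -/
theorem exists_isImpulseResponse {lam : ℝ} (hlam : 0 < lam) :
    ∃ g k : ℝ → ℝ, IsImpulseResponse lam g k := by
  let A : ℝ × ℝ →L[ℝ] ℝ × ℝ := (ContinuousLinearMap.snd ℝ ℝ ℝ).prod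
    (-lam • ContinuousLinearMap.fst ℝ ℝ ℝ - lam • ContinuousLinearMap.snd ℝ ℝ ℝ)
  have h : ∀ t : ℝ, HasDerivAt (fun u : ℝ => NormedSpace.exp (u • A) ((0, 1) : ℝ × ℝ))
      (A (NormedSpace.exp (t • A) ((0, 1) : ℝ × ℝ))) t := fun t =>
    (hasDerivAt_exp_smul_const' A t).clm_apply (hasDerivAt_const t ((0, 1) : ℝ × ℝ)) |>.congr_deriv
      (by simp)
  refine ⟨fun t => (NormedSpace.exp (t • A) ((0, 1) : ℝ × ℝ)).1,
    fun t => (NormedSpace.exp (t • A) ((0, 1) : ℝ × ℝ)).2, hlam, fun t => ?_, fun t => ?_, ?_, ?_⟩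
  · have := (ContinuousLinearMap.fst ℝ ℝ ℝ).hasFDerivAt.comp_hasDerivAt t (h t)
    exact this.congr_deriv (by simp [A])
  · have := (ContinuousLinearMap.snd ℝ ℝ ℝ).hasFDerivAt.comp_hasDerivAt t (h t)
    exact this.congr_deriv (by simp [A])
  · simp
  · simp

namespace IsImpulseResponse

variable {lam : ℝ} {g k : ℝ → ℝ} (h : IsImpulseResponse lam g k)

include h

theorem continuous_fst : Continuous g :=
  continuous_iff_continuousAt.2 fun t => (h.hasDerivAt_fst t).continuousAt

theorem continuous_snd : Continuous k :=
  continuous_iff_continuousAt.2 fun t => (h.hasDerivAt_snd t).continuousAt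

theorem hasDerivAt_quadratic (a b d t : ℝ) :
    HasDerivAt (fun t => a * g t ^ 2 + 2 * b * (g t * k t) + d * k t ^ 2)
      (-(2 * b * lam) * g t ^ 2 + (2 * a - 2 * b * lam - 2 * d * lam) * (g t * k t)
        + (2 * b - 2 * d * lam) * k t ^ 2) t := by
  have hg := h.hasDerivAt_fst t
  have hk := h.hasDerivAt_snd t
  refine ((((hg.pow 2).const_mul a).add ((hg.mul hk).const_mul (2 * b))).add
    ((hk.pow 2).const_mul d)).congr_deriv ?_
  norm_num
  ring

/-- Lyapunov's method: a positive definite quadratic form `V` in `(g, k)` with derivative `-(g² +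
k²)` satisfies `V' ≤ -V / C`, hence decays exponentially. -/
theorem tendsto_sq_add_sq : Tendsto (fun t => g t ^ 2 + k t ^ 2) atTop (𝓝 0) := by
  have hl := h.pos
  -- With leading coefficient `1 + b`, these values are forced by requiring the derivative of the
  -- form to be exactly `-(g² + k²)`.
  set b : ℝ := 1 / (2 * lam) with hb
  set d : ℝ := (1 + 1 / lam) / (2 * lam) with hd
  have hb0 : 0 < b := by positivity
  have hd0 : 0 < d := by positivity
  let V : ℝ → ℝ := fun t => (1 + b) * g t ^ 2 + 2 * b * (g t * k t) + d * k t ^ 2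
  have hV : ∀ t, HasDerivAt V (-(g t ^ 2 + k t ^ 2)) t := fun t =>
    (h.hasDerivAt_quadratic (1 + b) b d t).congr_deriv (by rw [hb, hd]; field_simp; ring)
  set C : ℝ := 1 + 2 * b + d with hC
  have hC0 : 0 < C := by positivity
  have hVC : ∀ t, V t ≤ C * (g t ^ 2 + k t ^ 2) := fun t => by
    simp only [V, hC]
    nlinarith [mul_nonneg hb0.le (sq_nonneg (g t - k t)), sq_nonneg (g t), sq_nonneg (k t),
      mul_nonneg hd0.le (sq_nonneg (g t)), mul_nonneg hb0.le (sq_nonneg (k t))]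
  have hanti : Antitone fun t => V t * Real.exp (t / C) := by
    refine antitone_of_hasDerivAt_nonpos (f' := fun t =>
      -(g t ^ 2 + k t ^ 2) * Real.exp (t / C) + V t * (Real.exp (t / C) * (1 / C)))
      (fun t => (hV t).mul (((hasDerivAt_id t).div_const C).exp)) fun t => ?_
    have : V t / C ≤ g t ^ 2 + k t ^ 2 := by
      rw [div_le_iff₀ hC0, mul_comm]; exact hVC t
    have e : -(g t ^ 2 + k t ^ 2) * Real.exp (t / C) + V t * (Real.exp (t / C) * (1 / C))
        = -((g t ^ 2 + k t ^ 2 - V t / C) * Real.exp (t / C)) := by ring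
    simp only [e, Pi.zero_apply]
    exact neg_nonpos.2 (mul_nonneg (sub_nonneg.2 this) (Real.exp_pos _).le)
  -- Completing the square, `V = g² + b (g + k)² + (d - b) k²`, which makes `V` positive definite.
  have hbd : d - b = 1 / (2 * lam ^ 2) := by rw [hb, hd]; field_simp; ring
  set e : ℝ := 1 / (2 * lam ^ 2) with he
  have he0 : 0 < e := by positivity
  have hVlow : ∀ t, g t ^ 2 + k t ^ 2 ≤ (1 + 1 / e) * V t := fun t => by
    have hV1 : g t ^ 2 + e * k t ^ 2 ≤ V t := by
      simp only [V]
      nlinarith [mul_nonneg hb0.le (sq_nonneg (g t + k t))]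
    calc g t ^ 2 + k t ^ 2 ≤ (1 + 1 / e) * (g t ^ 2 + e * k t ^ 2) := by
          have : (1 + 1 / e) * (g t ^ 2 + e * k t ^ 2)
            = g t ^ 2 + k t ^ 2 + (e * k t ^ 2 + 1 / e * g t ^ 2) := by field_simp; ring
          rw [this]
          have : 0 ≤ e * k t ^ 2 + 1 / e * g t ^ 2 := by positivity
          linarith
      _ ≤ _ := by gcongr
  have hVexp : ∀ t, 0 ≤ t → V t ≤ V 0 * Real.exp (-(t / C)) := fun t ht => by
    have := hanti ht
    simp only [zero_div, Real.exp_zero, mul_one] at this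
    rw [Real.exp_neg, ← div_eq_mul_inv, le_div_iff₀ (Real.exp_pos _)]
    exact this
  refine tendsto_of_tendsto_of_tendsto_of_le_of_le' (g := fun _ => 0)
    (h := fun t => (1 + 1 / e) * (V 0 * Real.exp (-(t / C)))) tendsto_const_nhds ?_
    (Eventually.of_forall fun t => by positivity) ?_
  · have : Tendsto (fun t : ℝ => Real.exp (-(t / C))) atTop (𝓝 0) :=
      Real.tendsto_exp_neg_atTop_nhds_zero.comp (tendsto_id.atTop_div_const hC0)
    simpa using (this.const_mul (V 0)).const_mul (1 + 1 / e)
  · filter_upwards [eventually_ge_atTop 0] with t ht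
    exact (hVlow t).trans (by gcongr; exact hVexp t ht)

theorem tendsto_fst : Tendsto g atTop (𝓝 0) := by
  have := squeeze_zero (fun t => sq_nonneg (g t))
    (fun t => le_add_of_nonneg_right (sq_nonneg (k t))) h.tendsto_sq_add_sq
  rw [tendsto_zero_iff_abs_tendsto_zero]
  simpa [Function.comp_def, Real.sqrt_sq_eq_abs] using this.sqrt

theorem tendsto_snd : Tendsto k atTop (𝓝 0) := by
  have := squeeze_zero (fun t => sq_nonneg (k t))
    (fun t => le_add_of_nonneg_left (sq_nonneg (g t))) h.tendsto_sq_add_sq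
  rw [tendsto_zero_iff_abs_tendsto_zero]
  simpa [Function.comp_def, Real.sqrt_sq_eq_abs] using this.sqrt

/-- A quadratic form in `(g, k)` has derivative `-g²`; its value at the initial state `(0, 1)` is
the coefficient `1 / (2 lam²)` of `k²`, and it vanishes at infinity. -/
theorem tendsto_integral_sq :
    Tendsto (fun t => ∫ s in (0 : ℝ)..t, g s ^ 2) atTop (𝓝 (1 / (2 * lam ^ 2))) := by
  have hl := h.pos
  have e : ∀ t, ∫ s in (0 : ℝ)..t, g s ^ 2 = 1 / (2 * lam ^ 2)
      - ((1 / 2 + 1 / (2 * lam)) * g t ^ 2 + 2 * (1 / (2 * lam)) * (g t * k t)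
        + 1 / (2 * lam ^ 2) * k t ^ 2) := fun t => by
    have hd : ∀ s ∈ Set.uIcc 0 t, HasDerivAt (fun t => -((1 / 2 + 1 / (2 * lam)) * g t ^ 2
        + 2 * (1 / (2 * lam)) * (g t * k t) + 1 / (2 * lam ^ 2) * k t ^ 2)) (g s ^ 2) s :=
      fun s _ => (h.hasDerivAt_quadratic (1 / 2 + 1 / (2 * lam)) (1 / (2 * lam))
        (1 / (2 * lam ^ 2)) s).neg.congr_deriv (by field_simp; ring)
    rw [intervalIntegral.integral_eq_sub_of_hasDerivAt hd
      ((h.continuous_fst.pow 2).intervalIntegrable _ _), h.fst_zero, h.snd_zero]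
    ring
  simp_rw [e]
  have := (((h.tendsto_fst.pow 2).const_mul (1 / 2 + 1 / (2 * lam))).add
    ((h.tendsto_fst.mul h.tendsto_snd).const_mul (2 * (1 / (2 * lam))))).add
    ((h.tendsto_snd.pow 2).const_mul (1 / (2 * lam ^ 2)))
  have := this.const_sub (1 / (2 * lam ^ 2))
  rwa [show ∀ a b c d : ℝ, d - (a * 0 ^ 2 + b * (0 * 0) + c * 0 ^ 2) = d from
    fun a b c d => by ring] at this

/-- Variation of constants for the damped oscillator driven by the increments of `b`. -/
theorem variation_of_constants {y z b : ℝ → ℝ} (hy : Continuous y) (hz : Continuous z)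
    (hb : Continuous b)
    (hy' : ∀ t, 0 ≤ t → y t = y 0 + ∫ s in (0 : ℝ)..t, z s)
    (hz' : ∀ t, 0 ≤ t → z t = z 0 + (∫ s in (0 : ℝ)..t, (-(lam * y s) - lam * z s)) + b t)
    {t : ℝ} (ht : 0 ≤ t) :
    y t = (k t + lam * g t) * y 0 + g t * z 0 + ∫ s in (0 : ℝ)..t, k (t - s) * b s := by
  have hcg := h.continuous_fst
  have hck := h.continuous_snd
  have hb0 : b 0 = 0 := by simpa using hz' 0 le_rfl
  have hyd : ∀ s ∈ Set.Ioo 0 t, HasDerivAt y (z s) s := fun s hs => by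
    have := (intervalIntegral.integral_hasDerivAt_right (hz.intervalIntegrable 0 s)
      (hz.stronglyMeasurableAtFilter _ _) hz.continuousAt).const_add (y 0)
    refine this.congr_of_eventuallyEq ?_
    filter_upwards [Ioi_mem_nhds hs.1] with r hr using hy' r (le_of_lt hr)
  have hc : Continuous fun s => -(lam * y s) - lam * z s := by fun_prop
  -- Only `z - b` is differentiable, since the noise path is not; the fundamental theorem below
  -- therefore pairs `g (t - s)` with `z - b`, leaving just `k (t - s) * b s` as derivative.
  have hzd : ∀ s ∈ Set.Ioo 0 t, HasDerivAt (fun s => z s - b s) (-(lam * y s) - lam * z s) s :=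
    fun s hs => by
    have := (intervalIntegral.integral_hasDerivAt_right (hc.intervalIntegrable 0 s)
      (hc.stronglyMeasurableAtFilter _ _) hc.continuousAt).const_add (z 0)
    refine this.congr_of_eventuallyEq ?_
    filter_upwards [Ioi_mem_nhds hs.1] with r hr
    rw [hz' r (le_of_lt hr)]; ring
  have key := intervalIntegral.integral_eq_sub_of_hasDerivAt_of_le
    (f := fun s => (k (t - s) + lam * g (t - s)) * y s + g (t - s) * (z s - b s))
    (f' := fun s => k (t - s) * b s) ht (by fun_prop) (fun s hs => ?_)
    ((by fun_prop : Continuous fun s => k (t - s) * b s).intervalIntegrable _ _)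
  · rw [key]
    simp only [sub_self, sub_zero, h.fst_zero, h.snd_zero, hb0]
    ring
  · have hts : HasDerivAt (fun s => t - s) (-1) s := by
      simpa using (hasDerivAt_id s).const_sub t
    have hg := (h.hasDerivAt_fst (t - s)).comp s hts
    have hk := (h.hasDerivAt_snd (t - s)).comp s hts
    refine (((hk.add (hg.const_mul lam)).mul (hyd s hs)).add (hg.mul (hzd s hs))).congr_deriv ?_
    simp only [Function.comp_def, Pi.add_apply]
    ring

/-- The Itô isometry for the impulse response, written through the covariance `min s r` of the
Brownian motion. -/
theorem integral_integral_mul_min {t : ℝ} (ht : 0 ≤ t) :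
    ∫ s in (0 : ℝ)..t, ∫ r in (0 : ℝ)..t, k (t - s) * k (t - r) * min s r
      = ∫ s in (0 : ℝ)..t, g s ^ 2 := by
  have hcg := h.continuous_fst
  have hck := h.continuous_snd
  have hts : ∀ s, HasDerivAt (fun s => t - s) (-1) s := fun s => by
    simpa using (hasDerivAt_id s).const_sub t
  have hg : ∀ s, HasDerivAt (fun s => g (t - s)) (-k (t - s)) s := fun s => by
    simpa [Function.comp_def] using (h.hasDerivAt_fst (t - s)).comp s (hts s)
  have hcgt : Continuous fun r => g (t - r) := by fun_prop
  have hckt : Continuous fun r => k (t - r) := by fun_prop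
  let G : ℝ → ℝ := fun s => ∫ r in (0 : ℝ)..s, g (t - r)
  have hG : ∀ s, HasDerivAt G (g (t - s)) s := fun s =>
    intervalIntegral.integral_hasDerivAt_right (hcgt.intervalIntegrable 0 s)
      (hcgt.stronglyMeasurableAtFilter _ _) hcgt.continuousAt
  -- Splitting at `r = s`, where `min s r` changes form, and integrating by parts: the boundary
  -- terms `g (t - s) * s` cancel. Afterwards `k (t - s) * G s - g (t - s) ^ 2` is the derivative of
  -- `-(g (t - s) * G s)`, which vanishes at both ends.
  have inner : ∀ s ∈ Set.uIcc 0 t, ∫ r in (0 : ℝ)..t, k (t - s) * k (t - r) * min s r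
      = k (t - s) * G s := fun s hs => by
    rw [Set.uIcc_of_le ht] at hs
    have hci : Continuous fun r => k (t - r) * min s r := by fun_prop
    simp_rw [mul_assoc, intervalIntegral.integral_const_mul]
    congr 1
    rw [← intervalIntegral.integral_add_adjacent_intervals (hci.intervalIntegrable 0 s)
      (hci.intervalIntegrable s t)]
    have h1 : ∫ r in (0 : ℝ)..s, k (t - r) * min s r = G s - g (t - s) * s := by
      have e : ∫ r in (0 : ℝ)..s, k (t - r) * min s r = ∫ r in (0 : ℝ)..s, k (t - r) * r := by
        refine intervalIntegral.integral_congr fun r hr => ?_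
        rw [Set.uIcc_of_le hs.1] at hr
        simp [min_eq_right hr.2]
      rw [e, intervalIntegral.integral_eq_sub_of_hasDerivAt (f := fun r => G r - g (t - r) * r)
        (fun r _ => ((hG r).sub ((hg r).mul (hasDerivAt_id r))).congr_deriv (by simp))
        ((by fun_prop : Continuous fun r => k (t - r) * r).intervalIntegrable _ _)]
      simp [G]
    have h2 : ∫ r in s..t, k (t - r) * min s r = g (t - s) * s := by
      have e : ∫ r in s..t, k (t - r) * min s r = ∫ r in s..t, k (t - r) * s := by
        refine intervalIntegral.integral_congr fun r hr => ?_
        rw [Set.uIcc_of_le hs.2] at hr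
        simp [min_eq_left hr.1]
      rw [e, intervalIntegral.integral_eq_sub_of_hasDerivAt (f := fun r => -(g (t - r) * s))
        (fun r _ => ((hg r).mul_const s).neg.congr_deriv (by ring))
        ((by fun_prop : Continuous fun r => k (t - r) * s).intervalIntegrable _ _)]
      simp [h.fst_zero]
    rw [h1, h2]; ring
  rw [intervalIntegral.integral_congr inner]
  have hcG : Continuous G := continuous_iff_continuousAt.2 fun s => (hG s).continuousAt
  have hsq : ∫ s in (0 : ℝ)..t, g s ^ 2 = ∫ s in (0 : ℝ)..t, g (t - s) ^ 2 := by
    simp [intervalIntegral.integral_comp_sub_left (fun s => g s ^ 2) t]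
  have hc1 : Continuous fun s => k (t - s) * G s := hckt.mul hcG
  have hc2 : Continuous fun s => g (t - s) ^ 2 := hcgt.pow 2
  have hc3 : Continuous fun s => k (t - s) * G s - g (t - s) ^ 2 := hc1.sub hc2
  rw [hsq, ← sub_eq_zero, ← intervalIntegral.integral_sub
    (hc1.intervalIntegrable _ _) (hc2.intervalIntegrable _ _),
    intervalIntegral.integral_eq_sub_of_hasDerivAt (f := fun s => -(g (t - s) * G s))
      (fun s _ => ((hg s).mul (hG s)).neg.congr_deriv (by simp; ring))
      (hc3.intervalIntegrable _ _)]
  simp [G, h.fst_zero]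

end IsImpulseResponse

/-! ### Second moments under perturbations that vanish in mean square. -/

section Moments

variable {Ω : Type*} [MeasurableSpace Ω] {P : Measure Ω}

theorem integral_sq_add (A M : Ω → ℝ) (hA : MemLp A 2 P) (hM : MemLp M 2 P) :
    ∫ ω, (A ω + M ω) ^ 2 ∂P = ∫ ω, A ω ^ 2 ∂P + 2 * ∫ ω, A ω * M ω ∂P + ∫ ω, M ω ^ 2 ∂P := by
  have hA2 := hA.integrable_sq
  have hAM : Integrable (fun ω => 2 * (A ω * M ω)) P := (hA.integrable_mul hM).const_mul 2
  have h2 : Integrable (fun ω => A ω ^ 2 + 2 * (A ω * M ω)) P := hA2.add hAM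
  rw [← integral_const_mul, ← integral_add hA2 hAM, ← integral_add h2 hM.integrable_sq]
  exact integral_congr_ae (.of_forall fun ω => by ring)

/-- Cauchy–Schwarz, from the discriminant of the nonnegative quadratic `x ↦ E (x A + M)²`. -/
theorem sq_integral_mul_le (A M : Ω → ℝ) (hA : MemLp A 2 P) (hM : MemLp M 2 P) :
    (∫ ω, A ω * M ω ∂P) ^ 2 ≤ (∫ ω, A ω ^ 2 ∂P) * ∫ ω, M ω ^ 2 ∂P := by
  have h : ∀ x : ℝ, 0 ≤ (∫ ω, A ω ^ 2 ∂P) * (x * x) + 2 * (∫ ω, A ω * M ω ∂P) * x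
      + ∫ ω, M ω ^ 2 ∂P := fun x => by
    have e := integral_sq_add (fun ω => x * A ω) M (hA.const_mul x) hM
    simp_rw [mul_pow, mul_assoc, integral_const_mul] at e
    have h0 : 0 ≤ ∫ ω, (x * A ω + M ω) ^ 2 ∂P := integral_nonneg fun ω => sq_nonneg _
    nlinarith
  have := discrim_le_zero h
  rw [discrim] at this
  nlinarith

/-- An `L²` perturbation tending to `0` does not affect the limit of the second moments. -/
theorem tendsto_integral_sq_add {ι : Type*} {l : Filter ι} {A M : ι → Ω → ℝ} {h : ℝ}
    (hA : ∀ t, MemLp (A t) 2 P) (hM : ∀ t, MemLp (M t) 2 P)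
    (hA0 : Tendsto (fun t => ∫ ω, A t ω ^ 2 ∂P) l (𝓝 0))
    (hMh : Tendsto (fun t => ∫ ω, M t ω ^ 2 ∂P) l (𝓝 h)) :
    Tendsto (fun t => ∫ ω, (A t ω + M t ω) ^ 2 ∂P) l (𝓝 h) := by
  have hc : Tendsto (fun t => ∫ ω, A t ω * M t ω ∂P) l (𝓝 0) := by
    have h2 := squeeze_zero (fun t => sq_nonneg _)
      (fun t => sq_integral_mul_le _ _ (hA t) (hM t)) (by simpa using hA0.mul hMh)
    rw [tendsto_zero_iff_abs_tendsto_zero]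
    simpa [Function.comp_def, Real.sqrt_sq_eq_abs] using h2.sqrt
  simp_rw [fun t => integral_sq_add _ _ (hA t) (hM t)]
  simpa using (hA0.add (hc.const_mul 2)).add hMh

theorem tendsto_integral_sq_sum {ι κ : Type*} {l : Filter ι} (S : Finset κ) {a : κ → ι → ℝ}
    {X : κ → Ω → ℝ} (ha : ∀ m ∈ S, Tendsto (a m) l (𝓝 0)) (hX : ∀ m ∈ S, MemLp (X m) 2 P) :
    Tendsto (fun t => ∫ ω, (∑ m ∈ S, a m t * X m ω) ^ 2 ∂P) l (𝓝 0) := by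
  have hb : Tendsto (fun t => (∑ m ∈ S, a m t ^ 2) * ∫ ω, ∑ m ∈ S, X m ω ^ 2 ∂P) l (𝓝 0) := by
    have : Tendsto (fun t => ∑ m ∈ S, a m t ^ 2) l (𝓝 0) := by
      simpa using tendsto_finsetSum S fun m hm => (ha m hm).pow 2
    simpa using this.mul_const (∫ ω, ∑ m ∈ S, X m ω ^ 2 ∂P)
  refine squeeze_zero (fun t => integral_nonneg fun ω => sq_nonneg _) (fun t => ?_) hb
  rw [← integral_const_mul]
  refine integral_mono (memLp_finsetSum S fun m hm => (hX m hm).const_mul _).integrable_sq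
    ((integrable_finsetSum S fun m hm => (hX m hm).integrable_sq).const_mul _) fun ω => ?_
  exact Finset.sum_mul_sq_le_sq_mul_sq S _ _

end Moments

/-! ### Fubini for time integrals of processes with almost surely continuous paths. -/

section TimeIntegrals

variable {Ω : Type*} [MeasurableSpace Ω] {P : Measure Ω}

/-- Joint measurability needs every path continuous. The bad set is null but perhaps not measurable,
so the process is set to zero on a measurable null hull of it. -/
theorem exists_measurable_uncurry_eq {X : ℝ → Ω → ℝ} (hm : ∀ s, Measurable (X s))
    (hc : ∀ᵐ ω ∂P, Continuous fun s => X s ω) :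
    ∃ X' : ℝ → Ω → ℝ, Measurable (Function.uncurry X') ∧ ∀ᵐ ω ∂P, ∀ s, X' s ω = X s ω := by
  let N := toMeasurable P {ω | ¬Continuous fun s => X s ω}
  have hN : ∀ᵐ ω ∂P, ω ∉ N :=
    measure_eq_zero_iff_ae_notMem.1 ((measure_toMeasurable _).trans (ae_iff.1 hc))
  refine ⟨fun s => Nᶜ.indicator (X s), measurable_uncurry_of_continuous_of_measurable
    (fun ω => ?_) fun s => (hm s).indicator (measurableSet_toMeasurable _ _).compl, ?_⟩
  · by_cases hω : ω ∈ N
    · simpa [hω] using continuous_const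
    · have : Continuous fun s => X s ω := by
        by_contra hcon
        exact hω (subset_toMeasurable P _ hcon)
      simpa [hω] using this
  · filter_upwards [hN] with ω hω s
    simp [hω]

variable [IsProbabilityMeasure P]

theorem integrable_uncurry_mul {t C : ℝ} {X Y : ℝ → Ω → ℝ}
    (hX : Measurable (Function.uncurry X)) (hY : Measurable (Function.uncurry Y))
    (hXL : ∀ s ∈ Set.Ioc 0 t, MemLp (X s) 2 P) (hYL : ∀ s ∈ Set.Ioc 0 t, MemLp (Y s) 2 P)
    (hXC : ∀ s ∈ Set.Ioc 0 t, ∫ ω, X s ω ^ 2 ∂P ≤ C)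
    (hYC : ∀ s ∈ Set.Ioc 0 t, ∫ ω, Y s ω ^ 2 ∂P ≤ C) :
    Integrable (fun p : (ℝ × ℝ) × Ω => X p.1.1 p.2 * Y p.1.2 p.2)
      (((volume.restrict (Set.Ioc 0 t)).prod (volume.restrict (Set.Ioc 0 t))).prod P) := by
  have hmeas : Measurable fun p : (ℝ × ℝ) × Ω => X p.1.1 p.2 * Y p.1.2 p.2 :=
    (hX.comp (by fun_prop : Measurable fun p : (ℝ × ℝ) × Ω => (p.1.1, p.2))).mul
      (hY.comp (by fun_prop : Measurable fun p : (ℝ × ℝ) × Ω => (p.1.2, p.2)))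
  have hmem : ∀ᵐ p : ℝ × ℝ ∂((volume.restrict (Set.Ioc 0 t)).prod (volume.restrict (Set.Ioc 0 t))),
      p.1 ∈ Set.Ioc 0 t ∧ p.2 ∈ Set.Ioc 0 t := by
    rw [Measure.prod_restrict]
    filter_upwards [ae_restrict_mem (measurableSet_Ioc.prod measurableSet_Ioc)] with p hp using hp
  rw [integrable_prod_iff hmeas.aestronglyMeasurable]
  refine ⟨?_, ?_⟩
  · filter_upwards [hmem] with p hp
    exact (hXL _ hp.1).integrable_mul (hYL _ hp.2)
  · refine Integrable.of_bound (C := C)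
      (hmeas.norm.stronglyMeasurable.integral_prod_right).aestronglyMeasurable ?_
    filter_upwards [hmem] with p hp
    have hi := ((hXL _ hp.1).integrable_mul (hYL _ hp.2)).norm
    rw [Real.norm_of_nonneg (integral_nonneg fun _ => norm_nonneg _)]
    -- The inequality `2 |x y| ≤ x² + y²` bounds the inner integral by `C` uniformly in time.
    have h2 : ∫ ω, ‖X p.1 ω * Y p.2 ω‖ ∂P ≤ ∫ ω, (X p.1 ω ^ 2 + Y p.2 ω ^ 2) / 2 ∂P := by
      refine integral_mono hi
        (((hXL _ hp.1).integrable_sq.add (hYL _ hp.2).integrable_sq).div_const 2) fun ω => ?_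
      simp only [Real.norm_eq_abs, abs_mul]
      nlinarith [sq_nonneg (|X p.1 ω| - |Y p.2 ω|), sq_abs (X p.1 ω), sq_abs (Y p.2 ω)]
    rw [integral_div, integral_add (hXL _ hp.1).integrable_sq (hYL _ hp.2).integrable_sq] at h2
    linarith [hXC _ hp.1, hYC _ hp.2]

/-- The mixed second moment of the time integrals of two processes with continuous paths is
the double integral of their covariances. -/
theorem integrable_and_integral_mul_integral {t C : ℝ} (ht : 0 ≤ t) {X Y : ℝ → Ω → ℝ}
    (hXm : ∀ s, Measurable (X s)) (hYm : ∀ s, Measurable (Y s))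
    (hXc : ∀ᵐ ω ∂P, Continuous fun s => X s ω) (hYc : ∀ᵐ ω ∂P, Continuous fun s => Y s ω)
    (hXL : ∀ s ∈ Set.Ioc 0 t, MemLp (X s) 2 P) (hYL : ∀ s ∈ Set.Ioc 0 t, MemLp (Y s) 2 P)
    (hXC : ∀ s ∈ Set.Ioc 0 t, ∫ ω, X s ω ^ 2 ∂P ≤ C)
    (hYC : ∀ s ∈ Set.Ioc 0 t, ∫ ω, Y s ω ^ 2 ∂P ≤ C) :
    Integrable (fun ω => (∫ s in (0 : ℝ)..t, X s ω) * ∫ s in (0 : ℝ)..t, Y s ω) P ∧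
    ∫ ω, (∫ s in (0 : ℝ)..t, X s ω) * (∫ s in (0 : ℝ)..t, Y s ω) ∂P
      = ∫ s in (0 : ℝ)..t, ∫ r in (0 : ℝ)..t, ∫ ω, X s ω * Y r ω ∂P := by
  obtain ⟨X', hX', hXX⟩ := exists_measurable_uncurry_eq hXm hXc
  obtain ⟨Y', hY', hYY⟩ := exists_measurable_uncurry_eq hYm hYc
  have hXs : ∀ s, X s =ᵐ[P] X' s := fun s => by filter_upwards [hXX] with ω h using (h s).symm
  have hYs : ∀ s, Y s =ᵐ[P] Y' s := fun s => by filter_upwards [hYY] with ω h using (h s).symm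
  have hint := integrable_uncurry_mul (P := P) (t := t) (C := C) hX' hY'
    (fun s hs => (hXL s hs).ae_eq (hXs s)) (fun s hs => (hYL s hs).ae_eq (hYs s))
    (fun s hs => (integral_congr_ae ((hXs s).fun_comp (· ^ 2))).symm.trans_le (hXC s hs))
    (fun s hs => (integral_congr_ae ((hYs s).fun_comp (· ^ 2))).symm.trans_le (hYC s hs))
  have hJ : (fun ω => (∫ s in (0 : ℝ)..t, X s ω) * ∫ s in (0 : ℝ)..t, Y s ω) =ᵐ[P]
      fun ω => ∫ p, X' p.1 ω * Y' p.2 ω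
        ∂((volume.restrict (Set.Ioc 0 t)).prod (volume.restrict (Set.Ioc 0 t))) := by
    filter_upwards [hXX, hYY] with ω h1 h2
    rw [integral_prod_mul (fun s => X' s ω) (fun s => Y' s ω)]
    simp only [h1, h2, intervalIntegral.integral_of_le ht]
  refine ⟨(integrable_congr hJ).2 hint.integral_prod_right, ?_⟩
  rw [integral_congr_ae hJ, ← integral_integral_swap hint, integral_prod _ hint.integral_prod_left]
  simp_rw [intervalIntegral.integral_of_le ht]
  refine integral_congr_ae (.of_forall fun s => integral_congr_ae (.of_forall fun r => ?_))
  exact integral_congr_ae ((hXs s).mul (hYs r)).symm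

theorem memLp_integral {t C : ℝ} (ht : 0 ≤ t) {X : ℝ → Ω → ℝ}
    (hXm : ∀ s, Measurable (X s)) (hXc : ∀ᵐ ω ∂P, Continuous fun s => X s ω)
    (hXL : ∀ s ∈ Set.Ioc 0 t, MemLp (X s) 2 P)
    (hXC : ∀ s ∈ Set.Ioc 0 t, ∫ ω, X s ω ^ 2 ∂P ≤ C) :
    MemLp (fun ω => ∫ s in (0 : ℝ)..t, X s ω) 2 P := by
  have hm : AEStronglyMeasurable (fun ω => ∫ s in (0 : ℝ)..t, X s ω) P := by
    obtain ⟨X', hX', hXX⟩ := exists_measurable_uncurry_eq hXm hXc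
    refine ⟨fun ω => ∫ s in Set.Ioc 0 t, X' s ω,
      hX'.stronglyMeasurable.integral_prod_left, ?_⟩
    filter_upwards [hXX] with ω h
    simp only [h, intervalIntegral.integral_of_le ht]
  rw [memLp_two_iff_integrable_sq hm]
  simpa only [sq] using
    (integrable_and_integral_mul_integral ht hXm hXm hXc hXc hXL hXL hXC hXC).1

end TimeIntegrals

/-! ### Eigenmodes of the Laplacian. -/

open Matrix

theorem exists_eigenmodes {V : Type*} [Fintype V] [DecidableEq V] {A : Matrix V V ℝ}
    (hA : A.PosSemidef) :
    ∃ (lam : V → ℝ) (v : V → V → ℝ), (∀ m, 0 ≤ lam m) ∧ (∀ m, A *ᵥ v m = lam m • v m) ∧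
      (∀ m n, v m ⬝ᵥ v n = if m = n then 1 else 0) ∧
      ∀ x y : V → ℝ, ∑ m, (v m ⬝ᵥ x) * (v m ⬝ᵥ y) = x ⬝ᵥ y := by
  let b := hA.isHermitian.eigenvectorBasis
  have hb : ∀ x y : EuclideanSpace ℝ V, inner ℝ x y = x.ofLp ⬝ᵥ y.ofLp := fun x y => by
    rw [EuclideanSpace.inner_eq_star_dotProduct, star_trivial, dotProduct_comm]
  refine ⟨hA.isHermitian.eigenvalues, fun m => b m, hA.eigenvalues_nonneg,
    hA.isHermitian.mulVec_eigenvectorBasis, fun m n => ?_, fun x y => ?_⟩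
  · rw [← hb, orthonormal_iff_ite.1 b.orthonormal]
  · have := b.sum_inner_mul_inner (WithLp.toLp 2 x) (WithLp.toLp 2 y)
    simp only [hb] at this
    simpa only [dotProduct_comm x] using this

theorem dotProduct_integral {V : Type*} [Fintype V] (v : V → ℝ) {f : ℝ → V → ℝ}
    (hf : Continuous f) (a b : ℝ) : v ⬝ᵥ ∫ s in a..b, f s = ∫ s in a..b, v ⬝ᵥ f s := by
  let T : (V → ℝ) →L[ℝ] ℝ := ∑ i, v i • ContinuousLinearMap.proj i
  have hT : ∀ x, T x = v ⬝ᵥ x := fun x => by simp [T, dotProduct]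
  simpa only [hT] using (T.intervalIntegral_comp_comm (hf.intervalIntegrable a b)).symm

theorem memLp_dotProduct {V Ω : Type*} [Fintype V] [MeasurableSpace Ω] {P : Measure Ω}
    (v : V → ℝ) {X : Ω → V → ℝ} (hX : MemLp X 2 P) : MemLp (fun ω => v ⬝ᵥ X ω) 2 P :=
  memLp_finsetSum _ fun i _ => (hX.eval i).const_mul (v i)

/-! ### Covariances of the noise and of the response to it. -/

namespace IsIndepBrownianFamily

variable {V Ω : Type*} [MeasurableSpace Ω] {P : Measure Ω} {W : V → ℝ≥0 → Ω → ℝ}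

theorem memLp (h : IsIndepBrownianFamily P W) (i : V) (t : ℝ≥0) : MemLp (W i t) 2 P :=
  ((h.isBrownian i).hasLaw_eval t).hasGaussianLaw.memLp_two

theorem integral_mul [DecidableEq V] [IsProbabilityMeasure P] (h : IsIndepBrownianFamily P W)
    (i j : V) (s r : ℝ≥0) :
    ∫ ω, W i s ω * W j r ω ∂P = if i = j then (min s r : ℝ) else 0 := by
  split_ifs with hij
  · subst hij
    have := covariance_eq_sub (h.memLp i s) (h.memLp i r)
    rw [(h.isBrownian i).covariance_eval, (h.isBrownian i).integral_eval, zero_mul, sub_zero]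
      at this
    exact this.symm.trans (by simp)
  · have hind : IndepFun (W i s) (W j r) P :=
      (h.indep.indepFun hij).comp (measurable_pi_apply s) (measurable_pi_apply r)
    rw [hind.integral_fun_mul_eq_mul_integral (h.measurable i s).aestronglyMeasurable
      (h.measurable j r).aestronglyMeasurable, (h.isBrownian i).integral_eval, zero_mul]

variable [Fintype V]

/-- The component of the noise along the vector `v`, with time extended to `ℝ`. -/
noncomputable def _root_.NoisyConsensus.noiseComponent (W : V → ℝ≥0 → Ω → ℝ) (v : V → ℝ) (s : ℝ)
    (ω : Ω) : ℝ := v ⬝ᵥ fun i => W i s.toNNReal ω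

theorem measurable_noiseComponent (h : IsIndepBrownianFamily P W) (v : V → ℝ) (s : ℝ) :
    Measurable (noiseComponent W v s) :=
  Finset.measurable_sum _ fun i _ => (h.measurable i _).const_mul _

theorem continuous_noiseComponent (h : IsIndepBrownianFamily P W) (v : V → ℝ) :
    ∀ᵐ ω ∂P, Continuous fun s => noiseComponent W v s ω := by
  filter_upwards [ae_all_iff.2 fun i => (h.isBrownian i).cont] with ω hω
  exact continuous_finsetSum _ fun i _ =>
    ((hω i).comp continuous_real_toNNReal).const_mul (v i)

theorem memLp_noiseComponent (h : IsIndepBrownianFamily P W) (v : V → ℝ) (s : ℝ) :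
    MemLp (noiseComponent W v s) 2 P :=
  memLp_finsetSum _ fun i _ => (h.memLp i _).const_mul _

theorem integral_noiseComponent_mul [DecidableEq V] [IsProbabilityMeasure P]
    (h : IsIndepBrownianFamily P W) (v w : V → ℝ) {s r : ℝ} (hs : 0 ≤ s) (hr : 0 ≤ r) :
    ∫ ω, noiseComponent W v s ω * noiseComponent W w r ω ∂P = (v ⬝ᵥ w) * min s r := by
  have hint : ∀ i j : V, Integrable
      (fun ω => v i * W i s.toNNReal ω * (w j * W j r.toNNReal ω)) P := fun i j =>
    ((h.memLp i _).const_mul _).integrable_mul ((h.memLp j _).const_mul _)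
  have hterm : ∀ i j : V, ∫ ω, v i * W i s.toNNReal ω * (w j * W j r.toNNReal ω) ∂P
      = if i = j then v i * w j * min s r else 0 := fun i j => by
    simp_rw [mul_mul_mul_comm]
    rw [integral_const_mul, h.integral_mul]
    simp [hs, hr]
  simp only [noiseComponent, dotProduct, Finset.sum_mul_sum]
  rw [integral_finsetSum _ fun i _ => integrable_finsetSum _ fun j _ => hint i j]
  simp_rw [integral_finsetSum _ fun j _ => hint _ j, hterm]
  simp [Finset.sum_mul]

/-- The response at time `t` of the mode `v` with velocity kernel `k` to the noise. -/
noncomputable def _root_.NoisyConsensus.noiseResponse (W : V → ℝ≥0 → Ω → ℝ) (v : V → ℝ)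
    (k : ℝ → ℝ) (t : ℝ) (ω : Ω) : ℝ := ∫ s in (0 : ℝ)..t, k (t - s) * noiseComponent W v s ω

theorem exists_second_moment_bound [DecidableEq V] [IsProbabilityMeasure P]
    (h : IsIndepBrownianFamily P W) (v : V → ℝ) {k : ℝ → ℝ} (hk : Continuous k) (t : ℝ) :
    ∃ C, ∀ s ∈ Set.Ioc 0 t, ∫ ω, (k (t - s) * noiseComponent W v s ω) ^ 2 ∂P ≤ C := by
  obtain ⟨C, hC⟩ := (isCompact_Icc (a := (0 : ℝ)) (b := t)).exists_bound_of_continuousOn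
    (f := fun s => k (t - s) ^ 2 * ((v ⬝ᵥ v) * s)) (by fun_prop)
  refine ⟨C, fun s hs => ?_⟩
  have e := h.integral_noiseComponent_mul v v hs.1.le hs.1.le
  simp_rw [← sq, min_self] at e
  simp_rw [mul_pow]
  rw [integral_const_mul, e]
  exact (le_abs_self _).trans (hC s (Set.Ioc_subset_Icc_self hs))

theorem memLp_noiseResponse [DecidableEq V] [IsProbabilityMeasure P]
    (h : IsIndepBrownianFamily P W) (v : V → ℝ) {k : ℝ → ℝ} (hk : Continuous k) {t : ℝ}
    (ht : 0 ≤ t) : MemLp (noiseResponse W v k t) 2 P := by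
  obtain ⟨C, hC⟩ := h.exists_second_moment_bound v hk t
  refine memLp_integral ht (fun s => (h.measurable_noiseComponent v s).const_mul _) ?_
    (fun s _ => (h.memLp_noiseComponent v s).const_mul _) hC
  filter_upwards [h.continuous_noiseComponent v] with ω hω
  fun_prop

theorem integral_noiseResponse_mul [DecidableEq V] [IsProbabilityMeasure P]
    (h : IsIndepBrownianFamily P W) (v w : V → ℝ) {k l : ℝ → ℝ} (hk : Continuous k)
    (hl : Continuous l) {t : ℝ} (ht : 0 ≤ t) :
    ∫ ω, noiseResponse W v k t ω * noiseResponse W w l t ω ∂P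
      = (v ⬝ᵥ w) * ∫ s in (0 : ℝ)..t, ∫ r in (0 : ℝ)..t, k (t - s) * l (t - r) * min s r := by
  obtain ⟨C, hC⟩ := h.exists_second_moment_bound v hk t
  obtain ⟨D, hD⟩ := h.exists_second_moment_bound w hl t
  refine (integrable_and_integral_mul_integral (C := max C D) ht
    (fun s => (h.measurable_noiseComponent v s).const_mul _)
    (fun s => (h.measurable_noiseComponent w s).const_mul _) ?_ ?_
    (fun s _ => (h.memLp_noiseComponent v s).const_mul _)
    (fun s _ => (h.memLp_noiseComponent w s).const_mul _)
    (fun s hs => (hC s hs).trans (le_max_left _ _))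
    (fun s hs => (hD s hs).trans (le_max_right _ _))).2.trans ?_
  · filter_upwards [h.continuous_noiseComponent v] with ω hω
    fun_prop
  · filter_upwards [h.continuous_noiseComponent w] with ω hω
    fun_prop
  · rw [← intervalIntegral.integral_const_mul]
    refine intervalIntegral.integral_congr fun s hs => ?_
    rw [Set.uIcc_of_le ht] at hs
    rw [← intervalIntegral.integral_const_mul]
    refine intervalIntegral.integral_congr fun r hr => ?_
    rw [Set.uIcc_of_le ht] at hr
    simp_rw [mul_mul_mul_comm]
    rw [integral_const_mul, h.integral_noiseComponent_mul v w hs.1 hr.1]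
    ring

end IsIndepBrownianFamily

/-! ### The limiting second moment on a general graph. -/

namespace IsSecondOrderConsensus

variable {V Ω : Type*} [Fintype V] [DecidableEq V] [MeasurableSpace Ω] {P : Measure Ω}
  {G : SimpleGraph V} [DecidableRel G.Adj] {W : V → ℝ≥0 → Ω → ℝ} {x₁ x₂ : ℝ≥0 → Ω → V → ℝ}

/-- Symmetry of the Laplacian lets an eigenvector decouple the system into one scalar oscillator.
The exceptional null set does not depend on `t`. -/
theorem mode_eq (h : IsSecondOrderConsensus G P W x₁ x₂) {lam : ℝ} {v : V → ℝ}
    (hv : G.lapMatrix ℝ *ᵥ v = lam • v) {g k : ℝ → ℝ} (hg : IsImpulseResponse lam g k) :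
    ∀ᵐ ω ∂P, ∀ t : ℝ≥0, v ⬝ᵥ x₁ t ω = (k t + lam * g t) * (v ⬝ᵥ x₁ 0 ω)
      + g t * (v ⬝ᵥ x₂ 0 ω) + noiseResponse W v k t ω := by
  have hL : ∀ x, v ⬝ᵥ (G.lapMatrix ℝ *ᵥ x) = lam * (v ⬝ᵥ x) := fun x => by
    rw [dotProduct_mulVec, ← mulVec_transpose, (G.isSymm_lapMatrix ℝ).eq, hv, smul_dotProduct,
      smul_eq_mul]
  filter_upwards [h.continuous_fst, h.continuous_snd, h.equation_fst, h.equation_snd,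
    h.noise.continuous_noiseComponent v] with ω hc1 hc2 he1 he2 hcW t
  have hc1' : Continuous fun s : ℝ => x₁ s.toNNReal ω := hc1.comp continuous_real_toNNReal
  have hc2' : Continuous fun s : ℝ => x₂ s.toNNReal ω := hc2.comp continuous_real_toNNReal
  have := hg.variation_of_constants (y := fun s => v ⬝ᵥ x₁ s.toNNReal ω)
    (z := fun s => v ⬝ᵥ x₂ s.toNNReal ω) (b := fun s => noiseComponent W v s ω)
    (by fun_prop) (by fun_prop) hcW (fun s hs => ?_) (fun s hs => ?_) t.coe_nonneg
  · simpa [noiseResponse] using this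
  · lift s to ℝ≥0 using hs
    simp only [Real.toNNReal_coe, Real.toNNReal_zero]
    rw [he1 s, dotProduct_add, dotProduct_integral v hc2']
  · lift s to ℝ≥0 using hs
    simp only [Real.toNNReal_coe, Real.toNNReal_zero]
    conv_lhs => rw [he2 s]
    rw [dotProduct_add, dotProduct_add, dotProduct_integral v (by fun_prop)]
    simp only [dotProduct_sub, dotProduct_neg, hL, noiseComponent, Real.toNNReal_coe]

/-- Along `L u`, with `u` orthogonal to the kernel of the Laplacian `L`, the second moment of the
position converges to half the squared length of `u`. -/
theorem tendsto_integral_sq [IsProbabilityMeasure P] (h : IsSecondOrderConsensus G P W x₁ x₂)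
    {u : V → ℝ} (hu : ∀ v, G.lapMatrix ℝ *ᵥ v = 0 → v ⬝ᵥ u = 0) :
    (∀ t, Integrable (fun ω => ((G.lapMatrix ℝ *ᵥ u) ⬝ᵥ x₁ t ω) ^ 2) P) ∧
      Tendsto (fun t => ∫ ω, ((G.lapMatrix ℝ *ᵥ u) ⬝ᵥ x₁ t ω) ^ 2 ∂P) atTop
        (𝓝 ((u ⬝ᵥ u) / 2)) := by
  obtain ⟨lam, v, hlam, hv, hvv, hsum⟩ := exists_eigenmodes (G.posSemidef_lapMatrix ℝ)
  choose! g k hgk using fun m (hm : 0 < lam m) => exists_isImpulseResponse hm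
  set S : Finset V := Finset.univ.filter fun m => 0 < lam m with hS
  have hmem : ∀ {m}, m ∈ S → 0 < lam m := fun hm => (Finset.mem_filter.1 hm).2
  have hzero : ∀ m ∉ S, v m ⬝ᵥ u = 0 := fun m hm => by
    have h0 : lam m = 0 := le_antisymm (by simpa [hS] using hm) (hlam m)
    exact hu _ (by rw [hv, h0, zero_smul])
  set γ : V → ℝ := fun m => lam m * (v m ⬝ᵥ u) with hγ
  have hvL : ∀ m, v m ⬝ᵥ (G.lapMatrix ℝ *ᵥ u) = γ m := fun m => by
    rw [dotProduct_mulVec, ← mulVec_transpose, (G.isSymm_lapMatrix ℝ).eq, hv, smul_dotProduct,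
      smul_eq_mul]
  have hdec : ∀ x : V → ℝ, (G.lapMatrix ℝ *ᵥ u) ⬝ᵥ x = ∑ m ∈ S, γ m * (v m ⬝ᵥ x) := fun x => by
    rw [← hsum, ← Finset.sum_subset (Finset.subset_univ S) fun m _ hm => ?_]
    · simp_rw [hvL]
    · rw [hvL, hγ]
      simp [hzero m hm]
  -- `M` is the response to the noise; `B` and `A` carry the initial velocity and position with
  -- coefficients tending to zero.
  let M : ℝ≥0 → Ω → ℝ := fun t ω => ∑ m ∈ S, γ m * noiseResponse W (v m) (k m) t ω
  let B : ℝ≥0 → Ω → ℝ := fun t ω => ∑ m ∈ S, (γ m * g m t) * (v m ⬝ᵥ x₂ 0 ω)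
  let A : ℝ≥0 → Ω → ℝ := fun t ω => ∑ m ∈ S, (γ m * (k m t + lam m * g m t)) * (v m ⬝ᵥ x₁ 0 ω)
  have hR : ∀ m ∈ S, ∀ t : ℝ≥0, MemLp (noiseResponse W (v m) (k m) t) 2 P := fun m hm t =>
    h.noise.memLp_noiseResponse _ (hgk m (hmem hm)).continuous_snd t.coe_nonneg
  have hML : ∀ t, MemLp (M t) 2 P := fun t =>
    memLp_finsetSum _ fun m hm => (hR m hm t).const_mul _
  have hBL : ∀ t, MemLp (B t) 2 P := fun t =>
    memLp_finsetSum _ fun m _ => (memLp_dotProduct _ h.initial_snd).const_mul _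
  have hAL : ∀ t, MemLp (A t) 2 P := fun t =>
    memLp_finsetSum _ fun m _ => (memLp_dotProduct _ h.initial_fst).const_mul _
  have heq : ∀ᵐ ω ∂P, ∀ t : ℝ≥0, (G.lapMatrix ℝ *ᵥ u) ⬝ᵥ x₁ t ω = A t ω + (B t ω + M t ω) := by
    have : ∀ᵐ ω ∂P, ∀ m : S, ∀ t : ℝ≥0, v m ⬝ᵥ x₁ t ω
        = (k m t + lam m * g m t) * (v m ⬝ᵥ x₁ 0 ω) + g m t * (v m ⬝ᵥ x₂ 0 ω)
          + noiseResponse W (v m) (k m) t ω :=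
      ae_all_iff.2 fun m => h.mode_eq (hv m) (hgk m (hmem m.2))
    filter_upwards [this] with ω hω t
    rw [hdec]
    simp only [A, B, M, ← Finset.sum_add_distrib]
    exact Finset.sum_congr rfl fun m hm => by rw [hω ⟨m, hm⟩ t]; ring
  have heq2 : ∀ t : ℝ≥0, (fun ω => ((G.lapMatrix ℝ *ᵥ u) ⬝ᵥ x₁ t ω) ^ 2) =ᵐ[P]
      fun ω => (A t ω + (B t ω + M t ω)) ^ 2 := fun t => by
    filter_upwards [heq] with ω hω using by rw [hω t]
  -- Off-diagonal terms carry the factor `v m ⬝ᵥ v n = 0`.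
  have hMt : ∀ t : ℝ≥0, ∫ ω, M t ω ^ 2 ∂P
      = ∑ m ∈ S, γ m ^ 2 * ∫ s in (0 : ℝ)..t, g m s ^ 2 := fun t => by
    have hint : ∀ m ∈ S, ∀ n ∈ S, Integrable (fun ω => γ m * noiseResponse W (v m) (k m) t ω
        * (γ n * noiseResponse W (v n) (k n) t ω)) P := fun m hm n hn =>
      ((hR m hm t).const_mul _).integrable_mul ((hR n hn t).const_mul _)
    simp only [M, sq (∑ m ∈ S, _), Finset.sum_mul_sum]
    rw [integral_finsetSum _ fun m hm => integrable_finsetSum _ fun n hn => hint m hm n hn]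
    refine Finset.sum_congr rfl fun m hm => ?_
    rw [integral_finsetSum _ fun n hn => hint m hm n hn, Finset.sum_eq_single m]
    · simp_rw [mul_mul_mul_comm]
      rw [integral_const_mul, h.noise.integral_noiseResponse_mul _ _
        (hgk m (hmem hm)).continuous_snd (hgk m (hmem hm)).continuous_snd t.coe_nonneg, hvv, if_pos rfl,
        one_mul, (hgk m (hmem hm)).integral_integral_mul_min t.coe_nonneg, sq]
    · intro n hn hnm
      simp_rw [mul_mul_mul_comm]
      rw [integral_const_mul, h.noise.integral_noiseResponse_mul _ _
        (hgk m (hmem hm)).continuous_snd (hgk n (hmem hn)).continuous_snd t.coe_nonneg, hvv,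
        if_neg hnm.symm, zero_mul, mul_zero]
    · exact fun hm' => absurd hm hm'
  have hreal : Tendsto (fun t : ℝ≥0 => (t : ℝ)) atTop atTop := NNReal.tendsto_coe_atTop.2 tendsto_id
  have hMlim : Tendsto (fun t => ∫ ω, M t ω ^ 2 ∂P) atTop (𝓝 ((u ⬝ᵥ u) / 2)) := by
    have hlim : (u ⬝ᵥ u) / 2 = ∑ m ∈ S, γ m ^ 2 * (1 / (2 * lam m ^ 2)) := by
      rw [← hsum, ← Finset.sum_subset (Finset.subset_univ S) fun m _ hm => by
        rw [hzero m hm, zero_mul], Finset.sum_div]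
      refine Finset.sum_congr rfl fun m hm => ?_
      have := (hmem hm).ne'
      simp only [hγ]
      field_simp
    simp_rw [hMt, hlim]
    exact tendsto_finsetSum _ fun m hm =>
      ((hgk m (hmem hm)).tendsto_integral_sq.comp hreal).const_mul _
  have hBlim : Tendsto (fun t => ∫ ω, B t ω ^ 2 ∂P) atTop (𝓝 0) :=
    tendsto_integral_sq_sum S (fun m hm => by
      simpa using ((hgk m (hmem hm)).tendsto_fst.comp hreal).const_mul (γ m))
      fun m _ => memLp_dotProduct _ h.initial_snd
  have hAlim : Tendsto (fun t => ∫ ω, A t ω ^ 2 ∂P) atTop (𝓝 0) :=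
    tendsto_integral_sq_sum S (fun m hm => by
      simpa using (((hgk m (hmem hm)).tendsto_snd.comp hreal).add
        (((hgk m (hmem hm)).tendsto_fst.comp hreal).const_mul (lam m))).const_mul (γ m))
      fun m _ => memLp_dotProduct _ h.initial_fst
  have hBM := fun t => (hBL t).add (hML t)
  refine ⟨fun t => (integrable_congr (heq2 t)).2 ((hAL t).add (hBM t)).integrable_sq, ?_⟩
  simp_rw [fun t => integral_congr_ae (heq2 t)]
  exact tendsto_integral_sq_add hAL hBM hAlim (tendsto_integral_sq_add hBL hML hBlim hMlim)

end IsSecondOrderConsensus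

/-! ### The path graph: explicit potentials and polynomial sums. -/

section Path

/-- The conditions `d 0 = d N = 0` are zero flux through the two ends, so the missing neighbours of
the end vertices need no separate formula. -/
theorem lapMatrix_pathGraph_mulVec {N : ℕ} {U d : ℕ → ℝ} (h0 : d 0 = 0) (hN : d N = 0)
    (hU : ∀ i, U (i + 1) = U i + d (i + 1)) (i : Fin N) :
    ((SimpleGraph.pathGraph N).lapMatrix ℝ *ᵥ fun j => U j) i = d i - d (i + 1) := by
  have hsum : ((SimpleGraph.pathGraph N).lapMatrix ℝ *ᵥ fun j => U j) i
      = ∑ j : Fin N, ((if (i : ℕ) + 1 = j then U i - U j else 0)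
        + if (j : ℕ) + 1 = i then U i - U j else 0) := by
    rw [SimpleGraph.lapMatrix_mulVec_apply, SimpleGraph.degree_eq_sum_if_adj,
      SimpleGraph.neighborFinset_eq_filter, Finset.sum_filter, Finset.sum_mul,
      ← Finset.sum_sub_distrib]
    refine Finset.sum_congr rfl fun j _ => ?_
    simp only [SimpleGraph.pathGraph_adj]
    by_cases h1 : (i : ℕ) + 1 = j <;> by_cases h2 : (j : ℕ) + 1 = i
    · omega
    all_goals simp [h1, h2]
  rw [hsum, Finset.sum_add_distrib,
    Fin.sum_univ_eq_sum_range (fun j => if (i : ℕ) + 1 = j then U i - U j else 0),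
    Fin.sum_univ_eq_sum_range (fun j => if j + 1 = (i : ℕ) then U i - U j else 0),
    Finset.sum_ite_eq]
  obtain ⟨i, hi⟩ := i
  simp only [Finset.mem_range]
  have e1 : (if i + 1 < N then U i - U (i + 1) else 0) = -d (i + 1) := by
    split_ifs with h
    · rw [hU]; ring
    · rw [show i + 1 = N by omega, hN, neg_zero]
  have e2 : ∑ j ∈ Finset.range N, (if j + 1 = i then U i - U j else 0) = d i := by
    cases i with
    | zero => simp [h0]
    | succ i =>
      simp only [Nat.add_right_cancel_iff, Finset.sum_ite_eq', Finset.mem_range]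
      rw [if_pos (by omega), hU]; ring
  rw [e1, e2]; ring

theorem dotProduct_eq_zero_of_lapMatrix_pathGraph {N : ℕ} {u v : Fin N → ℝ} (hu : ∑ i, u i = 0)
    (hv : (SimpleGraph.pathGraph N).lapMatrix ℝ *ᵥ v = 0) : v ⬝ᵥ u = 0 := by
  cases N with
  | zero => simp [dotProduct]
  | succ n =>
    have hc : ∀ i, v i = v 0 := fun i =>
      (SimpleGraph.lapMatrix_mulVec_eq_zero_iff_forall_reachable _).1 hv i 0
        ((SimpleGraph.pathGraph_connected n).preconnected i 0)
    simp [dotProduct, hc, ← Finset.mul_sum, hu]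

/-- A potential is determined up to a constant, and subtracting its mean makes it orthogonal to the
kernel, which consists of constants as the path is connected. The limit is half the centred sum of
squares. -/
theorem IsSecondOrderConsensus.tendsto_integral_sq_path {N : ℕ} (hN : 1 ≤ N) {Ω : Type*}
    [MeasurableSpace Ω] {P : Measure Ω} [IsProbabilityMeasure P] {W : Fin N → ℝ≥0 → Ω → ℝ}
    {x₁ x₂ : ℝ≥0 → Ω → Fin N → ℝ}
    (h : IsSecondOrderConsensus (SimpleGraph.pathGraph N) P W x₁ x₂)
    {U d : ℕ → ℝ} (h0 : d 0 = 0) (hdN : d N = 0) (hU : ∀ i, U (i + 1) = U i + d (i + 1)) :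
    (∀ t, Integrable (fun ω => (∑ i : Fin N, (d i - d (i + 1)) * x₁ t ω i) ^ 2) P) ∧
      Tendsto (fun t => ∫ ω, (∑ i : Fin N, (d i - d (i + 1)) * x₁ t ω i) ^ 2 ∂P) atTop
        (𝓝 ((∑ i ∈ Finset.range N, U i ^ 2 - (∑ i ∈ Finset.range N, U i) ^ 2 / N) / 2)) := by
  have hN0 : (N : ℝ) ≠ 0 := by positivity
  set m : ℝ := (∑ i ∈ Finset.range N, U i) / N with hm
  have hL : ∀ i : Fin N, ((SimpleGraph.pathGraph N).lapMatrix ℝ *ᵥ fun j => U j - m) i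
      = d i - d (i + 1) :=
    lapMatrix_pathGraph_mulVec (U := fun j => U j - m) h0 hdN fun i => by rw [hU]; ring
  have hsum : ∑ i : Fin N, (U i - m) = 0 := by
    rw [Fin.sum_univ_eq_sum_range (fun i => U i - m), Finset.sum_sub_distrib]
    simp [hm, mul_div_cancel₀ _ hN0]
  have hsq : (fun i : Fin N => U i - m) ⬝ᵥ (fun i : Fin N => U i - m)
      = ∑ i ∈ Finset.range N, U i ^ 2 - (∑ i ∈ Finset.range N, U i) ^ 2 / N := by
    simp only [dotProduct]
    rw [Fin.sum_univ_eq_sum_range (fun i => (U i - m) * (U i - m))]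
    have e : ∀ i, (U i - m) * (U i - m) = U i ^ 2 - 2 * m * U i + m ^ 2 := fun i => by ring
    simp_rw [e, Finset.sum_add_distrib, Finset.sum_sub_distrib, ← Finset.mul_sum]
    simp only [Finset.sum_const, Finset.card_range, nsmul_eq_mul, hm]
    field_simp
    ring
  have := h.tendsto_integral_sq (u := fun i : Fin N => U i - m)
    fun v hv => dotProduct_eq_zero_of_lapMatrix_pathGraph hsum hv
  rw [hsq] at this
  simpa only [dotProduct, hL] using this

theorem sum_range_mul_succ (n : ℕ) :
    ∑ i ∈ Finset.range n, (i : ℝ) * (i + 1) = (n - 1) * n * (n + 1) / 3 := by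
  induction n with
  | zero => simp
  | succ n ih => rw [Finset.sum_range_succ, ih]; push_cast; ring

theorem sum_range_sq_mul_succ_sq (n : ℕ) :
    ∑ i ∈ Finset.range n, ((i : ℝ) * (i + 1)) ^ 2
      = ((n : ℝ) - 1) * n * (n + 1) * (3 * (n : ℝ) ^ 2 - 2) / 15 := by
  induction n with
  | zero => simp
  | succ n ih => rw [Finset.sum_range_succ, ih]; push_cast; ring

theorem sum_range_succ_id (n : ℕ) :
    ∑ i ∈ Finset.range n, ((i : ℝ) + 1) = n * (n + 1) / 2 := by
  induction n with
  | zero => simp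
  | succ n ih => rw [Finset.sum_range_succ, ih]; push_cast; ring

theorem sum_range_succ_sq (n : ℕ) :
    ∑ i ∈ Finset.range n, ((i : ℝ) + 1) ^ 2 = (n : ℝ) * (n + 1) * (2 * n + 1) / 6 := by
  induction n with
  | zero => simp
  | succ n ih => rw [Finset.sum_range_succ, ih]; push_cast; ring

theorem sum_range_shifted_product (j n : ℕ) :
    ∑ l ∈ Finset.range n, ((j : ℝ) + 1 + l) * (j + 1 + l + 1) * (l + 1)
      = n ^ 2 * (n + 1) ^ 2 / 4 + (2 * j + 1) * (n * (n + 1) * (2 * n + 1) / 6)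
        + j * (j + 1) * (n * (n + 1) / 2) := by
  induction n with
  | zero => simp
  | succ n ih => rw [Finset.sum_range_succ, ih]; push_cast; ring

theorem isPairwiseVariance_path {N : ℕ} {Ω : Type*} [MeasurableSpace Ω] {P : Measure Ω}
    [IsProbabilityMeasure P] {W : Fin N → ℝ≥0 → Ω → ℝ} {x₁ x₂ : ℝ≥0 → Ω → Fin N → ℝ}
    (h : IsSecondOrderConsensus (SimpleGraph.pathGraph N) P W x₁ x₂) {j k : Fin N} (hkj : k < j) :
    IsPairwiseVariance P x₁ j k (pathPairwise N (j : ℕ) (k : ℕ)) := by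
  obtain ⟨j, hj⟩ := j
  obtain ⟨k, hk⟩ := k
  have hkj : k < j := hkj
  -- A unit current between `k` and `j`: the potential is flat, then a ramp of slope one, then flat
  -- at `j - k`.
  let d : ℕ → ℝ := fun i => if k < i ∧ i ≤ j then 1 else 0
  let U : ℕ → ℝ := fun i => if i ≤ k then 0 else if i ≤ j then (i : ℝ) - k else (j : ℝ) - k
  have hU : ∀ i, U (i + 1) = U i + d (i + 1) := fun i => by
    simp only [U, d]
    rcases lt_trichotomy i k with h | rfl | h
    · simp [show i + 1 ≤ k by omega, show i ≤ k by omega, show ¬k < i + 1 by omega]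
    · simp [show i + 1 ≤ j by omega]
    · rcases lt_or_ge i j with h' | h'
      · simp [show ¬i + 1 ≤ k by omega, show ¬i ≤ k by omega, show k < i + 1 by omega,
          show i + 1 ≤ j by omega, show i ≤ j by omega]
        ring
      · rcases eq_or_lt_of_le h' with rfl | h'
        · simp [show ¬j + 1 ≤ k by omega, show ¬j ≤ k by omega]
        · simp [show ¬i + 1 ≤ k by omega, show ¬i ≤ k by omega, show ¬i + 1 ≤ j by omega,
            show ¬i ≤ j by omega]
  have hd : ∀ i, d i - d (i + 1) = (if i = j then 1 else 0) - if i = k then 1 else 0 := fun i => by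
    simp only [d]
    rcases eq_or_ne i j with rfl | hij
    · simp [hkj, hkj.ne']
    · rcases eq_or_ne i k with rfl | hik
      · simp [hij, show i + 1 ≤ j by omega]
      · have : (k < i ∧ i ≤ j) ↔ (k < i + 1 ∧ i + 1 ≤ j) := by omega
        simp only [this, hij, hik, if_false, sub_self]
  have key := h.tendsto_integral_sq_path (by omega) (U := U) (d := d) (by simp [d])
    (by simp only [d]; rw [if_neg (by omega)]) hU
  have hx : ∀ x : Fin N → ℝ, ∑ i : Fin N, (d i - d (i + 1)) * x i = x ⟨j, hj⟩ - x ⟨k, hk⟩ :=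
    fun x => by
    simp_rw [hd, sub_mul, Finset.sum_sub_distrib, ite_mul, one_mul, zero_mul]
    have : ∀ (a : ℕ) (ha : a < N) (i : Fin N), ((i : ℕ) = a) = (i = ⟨a, ha⟩) := fun a ha i => by
      rw [Fin.ext_iff]
    simp_rw [this j hj, this k hk, Finset.sum_ite_eq', Finset.mem_univ, if_true]
  simp_rw [hx] at key
  -- The flat part at zero contributes nothing as `F 0 = 0`; the ramp has `j - k` vertices and the
  -- plateau beyond `j` has `N - j - 1`.
  have hsum : ∀ F : ℝ → ℝ, F 0 = 0 → ∑ i ∈ Finset.range N, F (U i)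
      = ∑ l ∈ Finset.range (j - k), F ((l : ℝ) + 1) + ((N : ℝ) - j - 1) * F ((j : ℝ) - k) :=
    fun F hF => by
    obtain ⟨q, rfl⟩ := Nat.exists_eq_add_of_le hkj.le
    obtain ⟨r, rfl⟩ := Nat.exists_eq_add_of_le (Nat.succ_le_of_lt hj)
    have e : (k + q).succ + r = (k + 1) + q + r := by omega
    rw [e, Finset.sum_range_add, Finset.sum_range_add]
    have s1 : ∑ i ∈ Finset.range (k + 1), F (U i) = 0 :=
      Finset.sum_eq_zero fun i hi => by
        have := Finset.mem_range.1 hi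
        simp [U, show i ≤ k by omega, hF]
    have s2 : ∑ i ∈ Finset.range q, F (U (k + 1 + i)) = ∑ l ∈ Finset.range q, F ((l : ℝ) + 1) :=
      Finset.sum_congr rfl fun i hi => by
        have := Finset.mem_range.1 hi
        simp only [U]
        rw [if_neg (by omega), if_pos (by omega)]
        congr 1; push_cast; ring
    have s3 : ∑ i ∈ Finset.range r, F (U (k + 1 + q + i)) = ∑ l ∈ Finset.range r, F q :=
      Finset.sum_congr rfl fun i hi => by
        simp only [U]
        rw [if_neg (by omega), if_neg (by omega)]
        congr 1; push_cast; ring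
    rw [s1, s2, s3, Nat.add_sub_cancel_left]
    simp only [Finset.sum_const, Finset.card_range, nsmul_eq_mul]
    push_cast
    rw [show (k : ℝ) + q - k = q by ring]
    ring
  have hval : (∑ i ∈ Finset.range N, U i ^ 2 - (∑ i ∈ Finset.range N, U i) ^ 2 / N) / 2
      = pathPairwise N j k := by
    have hN0 : (N : ℝ) ≠ 0 := by
      have : 0 < N := by omega
      positivity
    rw [hsum (· ^ 2) (by simp), hsum (fun x => x) rfl, sum_range_succ_sq, sum_range_succ_id,
      Nat.cast_sub hkj.le, pathPairwise]
    field_simp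
    ring
  rw [hval] at key
  exact key

theorem isVertexVariance_path {N : ℕ} {Ω : Type*} [MeasurableSpace Ω] {P : Measure Ω}
    [IsProbabilityMeasure P] {W : Fin N → ℝ≥0 → Ω → ℝ} {x₁ x₂ : ℝ≥0 → Ω → Fin N → ℝ}
    (h : IsSecondOrderConsensus (SimpleGraph.pathGraph N) P W x₁ x₂) (j : Fin N) :
    IsVertexVariance P x₁ j (pathVertex N (j : ℕ)) := by
  obtain ⟨j, hj⟩ := j
  have hN : 1 ≤ N := by omega
  have hN0 : (N : ℝ) ≠ 0 := by positivity
  -- The source `e_j - 1/N` summed from the left: `A` is the parabola from the uniform part, `B` the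
  -- ramp starting at `j`. At `i = N` the two contributions cancel because `j < N`.
  let d : ℕ → ℝ := fun i => (i : ℝ) / N - if j < i then 1 else 0
  let A : ℕ → ℝ := fun i => (i : ℝ) * (i + 1) / (2 * N)
  let B : ℕ → ℝ := fun i => if j < i then (i : ℝ) - j else 0
  have hU : ∀ i, A (i + 1) - B (i + 1) = A i - B i + d (i + 1) := fun i => by
    simp only [A, B, d]
    rcases lt_trichotomy i j with h | rfl | h
    · simp only [show ¬j < i + 1 by omega, show ¬j < i by omega, if_false]
      push_cast; field_simp; ring
    · simp only [show i < i + 1 by omega, show ¬i < i by omega, if_false, if_true]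
      push_cast; field_simp; ring
    · simp only [show j < i + 1 by omega, h, if_true]
      push_cast; field_simp; ring
  have hd : ∀ i, d i - d (i + 1) = (if i = j then 1 else 0) - 1 / N := fun i => by
    simp only [d]
    rcases lt_trichotomy i j with h | rfl | h
    · simp only [show ¬j < i + 1 by omega, show ¬j < i by omega, h.ne, if_false]
      push_cast; field_simp; ring
    · simp only [show i < i + 1 by omega, show ¬i < i by omega, if_false, if_true]
      push_cast; field_simp; ring
    · simp only [show j < i + 1 by omega, h, h.ne', if_true, if_false]
      push_cast; field_simp; ring
  have key := h.tendsto_integral_sq_path hN (U := fun i => A i - B i) (d := d) (by simp [d])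
    (by simp [d, hj, hN0]) hU
  have hx : ∀ x : Fin N → ℝ, ∑ i : Fin N, (d i - d (i + 1)) * x i = x ⟨j, hj⟩ - average x :=
    fun x => by
    simp_rw [hd, sub_mul, Finset.sum_sub_distrib, ite_mul, one_mul, zero_mul]
    have : ∀ i : Fin N, ((i : ℕ) = j) = (i = ⟨j, hj⟩) := fun i => by rw [Fin.ext_iff]
    simp_rw [this, Finset.sum_ite_eq', Finset.mem_univ, if_true, ← Finset.mul_sum, average,
      Fintype.card_fin]
    ring
  simp_rw [hx] at key
  have hval : (∑ i ∈ Finset.range N, (A i - B i) ^ 2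
      - (∑ i ∈ Finset.range N, (A i - B i)) ^ 2 / N) / 2 = pathVertex N j := by
    have hB : ∀ F : ℕ → ℝ → ℝ, (∀ i, F i 0 = 0) → ∑ i ∈ Finset.range N, F i (B i)
        = ∑ l ∈ Finset.range (N - (j + 1)), F (j + 1 + l) ((l : ℝ) + 1) := fun F hF => by
      conv_lhs => rw [show N = (j + 1) + (N - (j + 1)) by omega]
      rw [Finset.sum_range_add, Finset.sum_eq_zero fun i hi => ?_, zero_add]
      · refine Finset.sum_congr rfl fun l _ => ?_
        simp only [B]
        rw [if_pos (by omega)]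
        congr 1; push_cast; ring
      · have := Finset.mem_range.1 hi
        simp only [B]
        rw [if_neg (by omega), hF]
    have hA1 : ∑ i ∈ Finset.range N, A i = (N - 1) * N * (N + 1) / 3 / (2 * N) := by
      simp only [A]
      rw [← Finset.sum_div, sum_range_mul_succ]
    have hA2 : ∑ i ∈ Finset.range N, A i ^ 2
        = (N - 1) * N * (N + 1) * (3 * N ^ 2 - 2) / 15 / (2 * N) ^ 2 := by
      simp only [A, div_pow]
      rw [← Finset.sum_div, sum_range_sq_mul_succ_sq]
    have hAB : ∑ i ∈ Finset.range N, A i * B i = (((N - (j + 1) : ℕ) : ℝ) ^ 2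
        * ((N - (j + 1) : ℕ) + 1) ^ 2 / 4 + (2 * j + 1) * ((N - (j + 1) : ℕ)
        * ((N - (j + 1) : ℕ) + 1) * (2 * (N - (j + 1) : ℕ) + 1) / 6)
        + j * (j + 1) * ((N - (j + 1) : ℕ) * ((N - (j + 1) : ℕ) + 1) / 2)) / (2 * N) := by
      rw [hB (fun i x => A i * x) (by simp), ← sum_range_shifted_product, Finset.sum_div]
      refine Finset.sum_congr rfl fun l _ => ?_
      simp only [A]
      push_cast; ring
    have e : ∀ i, (A i - B i) ^ 2 = A i ^ 2 - 2 * (A i * B i) + B i ^ 2 := fun i => by ring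
    simp_rw [e, Finset.sum_add_distrib, Finset.sum_sub_distrib, ← Finset.mul_sum]
    rw [hA1, hA2, hAB, hB (fun _ x => x) (by simp), hB (fun _ x => x ^ 2) (by simp),
      sum_range_succ_sq, sum_range_succ_id, Nat.cast_sub (by omega), pathVertex]
    push_cast
    field_simp
    ring
  rw [hval] at key
  exact key

theorem sum_range_pathVertex {N : ℕ} (hN : 1 ≤ N) :
    ∑ j ∈ Finset.range N, pathVertex N j = pathTotal N := by
  have hN0 : (N : ℝ) ≠ 0 := by positivity
  -- The size parameter `ν` is separated from the number of terms `n`, so that induction on `n` is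
  -- possible.
  have hs : ∀ (ν : ℝ) (n : ℕ), ∑ j ∈ Finset.range n, pathVertex ν j = 1 / (360 * ν) *
      (n * (4 * ν ^ 4 + 1 - 5 * ν ^ 2) - 20 * ν ^ 2 * ((n - 1) * n * (n + 1))
        + 30 * ν * (n ^ 2 * (n ^ 2 - 1))
        - 4 * ((n - 1) * n * (n + 1) * (3 * n ^ 2 - 2))) := fun ν n => by
    induction n with
    | zero => simp
    | succ n ih => rw [Finset.sum_range_succ, ih, pathVertex]; push_cast; ring
  rw [hs, pathTotal]
  field_simp
  ring

theorem isTotalVariance_path {N : ℕ} (hN : 1 ≤ N) {Ω : Type*} [MeasurableSpace Ω] {P : Measure Ω}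
    [IsProbabilityMeasure P] {W : Fin N → ℝ≥0 → Ω → ℝ} {x₁ x₂ : ℝ≥0 → Ω → Fin N → ℝ}
    (h : IsSecondOrderConsensus (SimpleGraph.pathGraph N) P W x₁ x₂) :
    IsTotalVariance P x₁ (pathTotal N) := by
  refine ⟨fun t j => (isVertexVariance_path h j).1 t, ?_⟩
  rw [← sum_range_pathVertex hN, ← Fin.sum_univ_eq_sum_range (fun j => pathVertex N j)]
  exact tendsto_finsetSum _ fun j _ => (isVertexVariance_path h j).2

theorem pathTotal_isTheta : (fun N : ℕ => pathTotal N) =Θ[atTop] fun N : ℕ => (N : ℝ) ^ 4 := by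
  -- The leading coefficient is `2 / 360 = 1 / 180`. The threshold `N ≥ 2` makes `5 N² - 7`
  -- positive; the total vanishes at `N = 1`.
  refine ⟨IsBigO.of_bound 1 ?_, IsBigO.of_bound 180 ?_⟩ <;>
    filter_upwards [eventually_ge_atTop 2] with N hN
  all_goals
    have h2 : (2 : ℝ) ≤ N := by exact_mod_cast hN
    have h4 : (4 : ℝ) ≤ (N : ℝ) ^ 2 := by nlinarith
    have h16 : (N : ℝ) ^ 2 ≤ (N : ℝ) ^ 4 := by nlinarith
    have hp : 0 ≤ pathTotal N := by rw [pathTotal]; nlinarith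
    rw [Real.norm_of_nonneg hp, Real.norm_of_nonneg (by positivity), pathTotal]
    nlinarith

end Path

end NoisyConsensus

theorem mainTheorem10 :
    (∀ N : ℕ, 1 ≤ N →
      ∀ (Ω : Type u) [MeasurableSpace Ω] (P : Measure Ω) [IsProbabilityMeasure P]
        (W : Fin N → ℝ≥0 → Ω → ℝ) (x₁ x₂ : ℝ≥0 → Ω → Fin N → ℝ),
        NoisyConsensus.IsSecondOrderConsensus (SimpleGraph.pathGraph N) P W x₁ x₂ →
          (∀ j k : Fin N, k < j →
            NoisyConsensus.IsPairwiseVariance P x₁ j k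
              (NoisyConsensus.pathPairwise (N : ℝ) ((j : ℕ) : ℝ) ((k : ℕ) : ℝ))) ∧
          (∀ j : Fin N,
            NoisyConsensus.IsVertexVariance P x₁ j
              (NoisyConsensus.pathVertex (N : ℝ) ((j : ℕ) : ℝ))) ∧
          NoisyConsensus.IsTotalVariance P x₁ (NoisyConsensus.pathTotal (N : ℝ))) ∧
    (∀ H : ℕ → ℝ,
      (∀ N : ℕ, 1 ≤ N →
        ∃ (Ω : Type u) (_ : MeasurableSpace Ω) (P : Measure Ω) (_ : IsProbabilityMeasure P)
          (W : Fin N → ℝ≥0 → Ω → ℝ) (x₁ x₂ : ℝ≥0 → Ω → Fin N → ℝ),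
          NoisyConsensus.IsSecondOrderConsensus (SimpleGraph.pathGraph N) P W x₁ x₂ ∧
            NoisyConsensus.IsTotalVariance P x₁ (H N)) →
      H =Θ[atTop] fun N : ℕ => (N : ℝ) ^ 4) := by
  refine ⟨fun N hN Ω _ P _ W x₁ x₂ h => ⟨fun j k hkj => NoisyConsensus.isPairwiseVariance_path h hkj,
    NoisyConsensus.isVertexVariance_path h, NoisyConsensus.isTotalVariance_path hN h⟩,
    fun H hH => EventuallyEq.trans_isTheta ?_ NoisyConsensus.pathTotal_isTheta⟩
  filter_upwards [eventually_ge_atTop 1] with N hN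
  obtain ⟨Ω, _, P, _, W, x₁, x₂, h, hT⟩ := hH N hN
  -- Limits are unique, so any realization gives the same total variance.
  exact tendsto_nhds_unique hT.2 (NoisyConsensus.isTotalVariance_path hN h).2
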